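/- Let $n,d\ge 1$, let $B_2^n$ be the closed Euclidean unit ball of $\mathbb{R}^n$, and let $A\subset B_2^n$ be non-empty. On a probability space, let $X$ be a standard Gaussian random vector in $\mathbb{R}^d$ (centered, with covariance $\mathrm{Id}_d$), let $X_1,\dots,X_n$ be independent copies of $X$, independent of $X$, and let $g_1,\dots,g_n$ be independent standard Gaussian real random variables, independent of $\{X,X_1,\dots,X_n\}$. For $x=(x^1,\dots,x^n)\in\mathbb{R}^n$ put $$X_x=\sum_{i=1}^n x^i X_i,\qquad g_x=\sum_{i=1}^n x^i g_i .$$ Let $(F_x)_{x\in A}$ be any family of functions $F_x:\mathbb{R}^d\to\mathbb{R}$ that are $1$-Lipschitz for the Euclidean norm. Then $$\mathbb{E}\,\sup_{x\in A} F_x(X_x)\;\le\;\mathbb{E}\,\sup_{x\in A}\bigl\{F_x(\|x\|_2\,X)+g_x\bigr\}.$$ Here the suprema are taken pointwise, with values in $(-\infty,+\infty]$; both are measurable (up to a null set) and have a well-defined expectation in the extended reals $[-\infty,+\infty]$. -/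

import Mathlib

open MeasureTheory ProbabilityTheory

/-- An extended-real random variable has a well-defined expectation in `[-∞, ∞]`: it is measurable
(up to a null set) and its positive part or its negative part has a finite integral. -/
def HasExpectation {Ω : Type*} [MeasurableSpace Ω] (P : Measure Ω) (Z : Ω → EReal) : Prop :=
  AEMeasurable Z P ∧
    ((∫⁻ ω, (Z ω).toENNReal ∂P) ≠ ⊤ ∨ (∫⁻ ω, (-Z ω).toENNReal ∂P) ≠ ⊤)

/-- The expectation `𝔼 Z = 𝔼 Z⁺ - 𝔼 Z⁻` of an extended-real random variable, with values in
`[-∞, ∞]`; it is meaningful when `HasExpectation P Z` holds. -/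
noncomputable def expectation {Ω : Type*} [MeasurableSpace Ω] (P : Measure Ω) (Z : Ω → EReal) :
    EReal :=
  ((∫⁻ ω, (Z ω).toENNReal ∂P : ENNReal) : EReal) - ((∫⁻ ω, (-Z ω).toENNReal ∂P : ENNReal) : EReal)

/-!
The proof is a Gaussian interpolation between two processes indexed by a finite set of points of
`A`. All the variables are read off one standard Gaussian vector `G = (g, X, Xs)` of a Euclidean
space, and the angle `θ` rotates `‖x‖ X` (at `θ = 0`) into `X_x = ∑ xⁱ Xs i` (at `θ = π / 2`),
while the real process `g_x` is multiplied by `cos θ`. With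
`w_x(θ) = β (F_x(cos θ ‖x‖ X + sin θ X_x) + cos θ g_x)`, the free energy
`φ(θ) = 𝔼 log ∑ exp w_x(θ)` is shown to be nonincreasing on `[0, π / 2]`
(`ComparisonData.freeEnergy_le`).

The derivative of `φ` is computed by Gaussian integration by parts
(`integral_inner_mul_stdGaussian`). Since `‖x‖ X` and `X_x` are independent with the same
covariance, the velocity `-sin θ ‖x‖ X + cos θ X_x` is independent of the position
`cos θ ‖x‖ X + sin θ X_x`; hence no second derivative of `F_x` appears, and it is enough that the
`F_x` be continuously differentiable.
With Gibbs weights `σ_x` proportional to `exp w_x`, the result is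
`φ' = β² sin θ cos θ 𝔼 ∑ σ_x σ_y [(‖x‖‖y‖ - ⟪x, y⟫) ⟪∇F_x, ∇F_y⟫ - ‖x‖² + ⟪x, y⟫]`.
As the gradients have norm at most one, the bracket is at most `‖x‖‖y‖ - ‖x‖²`, which after
symmetrisation in `x` and `y` is `-(‖x‖ - ‖y‖)² / 2 ≤ 0`
(`ComparisonData.pairwise_speed_nonpos`).

Letting `β → ∞` gives the inequality for finite maxima of `C¹` functions, mollification removes the
smoothness (`ComparisonData.integral_sup'_le`), and monotone convergence along a sequence of points
of `A` which realises the supremum everywhere (`exists_seq_iSup_eq`) gives the general case.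
-/

section

open Real Filter Topology Finset
open scoped RealInnerProductSpace ENNReal

/-! ### Gaussian integration by parts -/

section Gaussian

variable {E : Type*} [NormedAddCommGroup E] [InnerProductSpace ℝ E] [FiniteDimensional ℝ E]
  [MeasurableSpace E] [BorelSpace E]

/-- The density of the standard Gaussian measure with respect to Lebesgue measure. -/
noncomputable def gaussianDensity (E : Type*) [NormedAddCommGroup E] [InnerProductSpace ℝ E]
    (x : E) : ℝ :=
  (2 * π) ^ (-(Module.finrank ℝ E : ℝ) / 2) * exp (-‖x‖ ^ 2 / 2)

omit [FiniteDimensional ℝ E] [MeasurableSpace E] [BorelSpace E] in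
lemma gaussianDensity_nonneg (x : E) : 0 ≤ gaussianDensity E x := by
  unfold gaussianDensity; positivity

omit [FiniteDimensional ℝ E] [MeasurableSpace E] [BorelSpace E] in
lemma continuous_gaussianDensity : Continuous (gaussianDensity E) := by
  unfold gaussianDensity; fun_prop

lemma integrable_gaussianDensity : Integrable (gaussianDensity E) := by
  have h := GaussianFourier.integrable_cexp_neg_mul_sq_norm_add (V := E) (b := 1 / 2)
    (by norm_num) 0 0
  refine (h.re.const_mul ((2 * π) ^ (-(Module.finrank ℝ E : ℝ) / 2))).congr
    (Eventually.of_forall fun x => ?_)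
  have : (-(1 / 2 : ℂ) * (‖x‖ : ℂ) ^ 2 + 0 * (⟪(0 : E), x⟫ : ℂ)) = ((-‖x‖ ^ 2 / 2 : ℝ) : ℂ) := by
    push_cast; ring
  simp only [this, gaussianDensity]
  exact congrArg _ (Complex.exp_ofReal_re _)

/-- Proved by comparison of characteristic functions. -/
lemma stdGaussian_eq_withDensity :
    stdGaussian E = volume.withDensity (fun x => ENNReal.ofReal (gaussianDensity E x)) := by
  have hfin : IsFiniteMeasure
      (volume.withDensity (fun x => ENNReal.ofReal (gaussianDensity E x))) :=
    isFiniteMeasure_withDensity_ofReal integrable_gaussianDensity.2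
  refine Measure.ext_of_charFun ?_
  ext t
  rw [charFun_stdGaussian, charFun_apply, integral_withDensity_eq_integral_toReal_smul
    (by have := continuous_gaussianDensity (E := E); fun_prop) (by simp)]
  have h := GaussianFourier.integral_cexp_neg_mul_sq_norm_add (V := E) (b := 1 / 2)
    (by norm_num) Complex.I t
  have e : ∀ x : E, (ENNReal.ofReal (gaussianDensity E x)).toReal •
      Complex.exp ((⟪x, t⟫ : ℂ) * Complex.I) =
      (((2 * π) ^ (-(Module.finrank ℝ E : ℝ) / 2) : ℝ) : ℂ) *
        Complex.exp (-(1 / 2) * (‖x‖ : ℂ) ^ 2 + Complex.I * (⟪t, x⟫ : ℂ)) := by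
    intro x
    rw [ENNReal.toReal_ofReal (gaussianDensity_nonneg x), gaussianDensity, Complex.real_smul,
      Complex.exp_add, real_inner_comm, mul_comm Complex.I]
    push_cast
    rw [mul_assoc]
    congr 4
    ring
  simp_rw [e]
  rw [integral_const_mul, h, ← mul_assoc]
  have h2 : (((2 * π) ^ (-(Module.finrank ℝ E : ℝ) / 2) : ℝ) : ℂ) *
      ((π : ℂ) / (1 / 2)) ^ ((Module.finrank ℝ E : ℂ) / 2) = 1 := by
    have : ((π : ℂ) / (1 / 2)) ^ ((Module.finrank ℝ E : ℂ) / 2) =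
        (((2 * π) ^ ((Module.finrank ℝ E : ℝ) / 2) : ℝ) : ℂ) := by
      rw [Complex.ofReal_cpow (by positivity)]
      push_cast
      congr 1
      ring
    rw [this, ← Complex.ofReal_mul, ← Real.rpow_add (by positivity)]
    simp [neg_div]
  rw [h2, one_mul]
  congr 1
  rw [Complex.I_sq]
  ring

/-- **Gaussian integration by parts** in a single direction `a`. Only the line derivative of `H`
in that direction is needed. -/
theorem integral_inner_mul_stdGaussian {H H' : E → ℝ} {a : E} {C C' : ℝ}
    (hH : Continuous H) (hH' : Continuous H') (hC : ∀ x, |H x| ≤ C) (hC' : ∀ x, |H' x| ≤ C')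
    (hd : ∀ x, HasLineDerivAt ℝ H (H' x) x a) :
    ∫ x, ⟪a, x⟫ * H x ∂(stdGaussian E) = ∫ x, H' x ∂(stdGaussian E) := by
  have hmeas : Measurable fun x => ENNReal.ofReal (gaussianDensity E x) := by
    have := continuous_gaussianDensity (E := E); fun_prop
  have key : ∀ f : E → ℝ, Integrable f (stdGaussian E) →
      Integrable (fun x => gaussianDensity E x * f x) := by
    intro f hf
    rw [stdGaussian_eq_withDensity,
      integrable_withDensity_iff_integrable_smul' hmeas (by simp)] at hf
    simpa [ENNReal.toReal_ofReal (gaussianDensity_nonneg _)] using hf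
  have key2 : ∀ f : E → ℝ, ∫ x, f x ∂(stdGaussian E) = ∫ x, gaussianDensity E x * f x := by
    intro f
    rw [stdGaussian_eq_withDensity,
      integral_withDensity_eq_integral_toReal_smul hmeas (by simp)]
    simp [ENNReal.toReal_ofReal (gaussianDensity_nonneg _)]
  have hid : Integrable (fun x : E => ⟪a, x⟫) (stdGaussian E) :=
    IsGaussian.integrable_dual (stdGaussian E) (innerSL ℝ a)
  have i1 : Integrable (fun x => ⟪a, x⟫ * H x) (stdGaussian E) :=
    hid.mul_bdd hH.aestronglyMeasurable (Eventually.of_forall hC)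
  have i2 : Integrable H (stdGaussian E) :=
    .of_bound hH.aestronglyMeasurable C (Eventually.of_forall hC)
  have i3 : Integrable H' (stdGaussian E) :=
    .of_bound hH'.aestronglyMeasurable C' (Eventually.of_forall hC')
  -- the line derivative of the density produces the factor `⟪a, x⟫`
  have hρ : ∀ x : E,
      HasLineDerivAt ℝ (gaussianDensity E) (-(gaussianDensity E x * ⟪a, x⟫)) x a := by
    intro x
    have h1 : HasFDerivAt (fun y : E => ‖y‖ ^ 2) (2 • (innerSL ℝ x)) x :=
      (hasStrictFDerivAt_norm_sq x).hasFDerivAt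
    have h2 := ((((h1.neg).mul_const (1 / 2 : ℝ)).exp).const_mul
      ((2 * π) ^ (-(Module.finrank ℝ E : ℝ) / 2))).hasLineDerivAt a
    convert! h2 using 1
    · ext y; simp [gaussianDensity, div_eq_mul_inv]
    · simp [gaussianDensity, div_eq_mul_inv, real_inner_comm]
      ring
  have ibp := integral_bilinear_hasLineDerivAt_right_eq_neg_left_of_integrable
    (μ := (volume : Measure E)) (B := ContinuousLinearMap.mul ℝ ℝ)
    (f := gaussianDensity E) (f' := fun x => -(gaussianDensity E x * ⟪a, x⟫)) (g := H) (g' := H')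
    (v := a) (by simpa [mul_assoc] using (key _ i1).neg) (by simpa using key _ i3)
    (by simpa using key _ i2) (fun x _ => hρ x) (fun x _ => hd x)
  simp only [ContinuousLinearMap.mul_apply', neg_mul, integral_neg, neg_neg] at ibp
  rw [key2, key2, ibp]
  simp [mul_assoc]

end Gaussian

/-! ### The soft maximum and its gradient -/

section Softmax

variable {S : Type*} [Fintype S]

/-- The soft maximum `log ∑ exp (w t)` of a finite family. -/
noncomputable def logSumExp (w : S → ℝ) : ℝ := log (∑ t, exp (w t))

/-- The Gibbs weights `exp (w s) / ∑ exp (w t)`, which form the gradient of `logSumExp`. -/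
noncomputable def softmax (w : S → ℝ) (s : S) : ℝ := exp (w s) / ∑ t, exp (w t)

variable [Nonempty S]

lemma sum_exp_pos (w : S → ℝ) : 0 < ∑ t, exp (w t) :=
  sum_pos (fun _ _ => exp_pos _) univ_nonempty

lemma softmax_nonneg (w : S → ℝ) (s : S) : 0 ≤ softmax w s :=
  div_nonneg (exp_pos _).le (sum_exp_pos w).le

lemma sum_softmax (w : S → ℝ) : ∑ s, softmax w s = 1 := by
  simp only [softmax, ← sum_div]
  exact div_self (sum_exp_pos w).ne'

lemma softmax_le_one (w : S → ℝ) (s : S) : softmax w s ≤ 1 := by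
  rw [← sum_softmax w]
  exact single_le_sum (fun t _ => softmax_nonneg w t) (mem_univ s)

lemma abs_softmax_le_one (w : S → ℝ) (s : S) : |softmax w s| ≤ 1 := by
  rw [abs_of_nonneg (softmax_nonneg w s)]
  exact softmax_le_one w s

lemma abs_softmax_mul_sum_le (w : S → ℝ) (s : S) {c C : S → ℝ} (h : ∀ t, |c t| ≤ C t) :
    |softmax w s * ∑ t, softmax w t * c t| ≤ ∑ t, C t := by
  have hc : ∀ t, |softmax w t * c t| ≤ C t := fun t => by
    rw [abs_mul]
    exact (mul_le_of_le_one_left (abs_nonneg _) (abs_softmax_le_one w t)).trans (h t)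
  rw [abs_mul]
  exact (mul_le_of_le_one_left (abs_nonneg _) (abs_softmax_le_one w s)).trans
    ((abs_sum_le_sum_abs _ _).trans (sum_le_sum fun t _ => hc t))

lemma hasDerivAt_logSumExp {w : ℝ → S → ℝ} {w' : S → ℝ} {r : ℝ}
    (hw : ∀ s, HasDerivAt (fun r => w r s) (w' s) r) :
    HasDerivAt (fun r => logSumExp (w r)) (∑ s, softmax (w r) s * w' s) r := by
  have h := (HasDerivAt.fun_sum (u := univ) fun s _ => (hw s).exp).log (sum_exp_pos (w r)).ne'
  convert! h using 1
  rw [sum_div]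
  exact sum_congr rfl fun s _ => by rw [softmax]; ring

lemma hasDerivAt_softmax {w : ℝ → S → ℝ} {w' : S → ℝ} {r : ℝ}
    (hw : ∀ s, HasDerivAt (fun r => w r s) (w' s) r) (s : S) :
    HasDerivAt (fun r => softmax (w r) s)
      (softmax (w r) s * ∑ t, softmax (w r) t * (w' s - w' t)) r := by
  have h := (hw s).exp.div (HasDerivAt.fun_sum (u := univ) fun s _ => (hw s).exp)
    (sum_exp_pos (w r)).ne'
  convert! h using 1
  have h1 : ∑ t, softmax (w r) t * (w' s - w' t) =
      w' s - (∑ t, exp (w r t) * w' t) / ∑ t, exp (w r t) := by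
    simp only [mul_sub, sum_sub_distrib, ← sum_mul, sum_softmax, one_mul, sum_div]
    congr 1
    exact sum_congr rfl fun t _ => by rw [softmax]; ring
  rw [h1, softmax]
  have := (sum_exp_pos (w r)).ne'
  field_simp

lemma continuous_logSumExp : Continuous (logSumExp (S := S)) := by
  unfold logSumExp
  exact Continuous.log (by fun_prop) fun w => (sum_exp_pos w).ne'

lemma continuous_softmax (s : S) : Continuous fun w : S → ℝ => softmax w s := by
  unfold softmax
  exact Continuous.div (by fun_prop) (by fun_prop) fun w => (sum_exp_pos w).ne'

lemma le_logSumExp (w : S → ℝ) (s : S) : w s ≤ logSumExp w := by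
  rw [logSumExp, le_log_iff_exp_le (sum_exp_pos w)]
  exact single_le_sum (f := fun t => exp (w t)) (fun t _ => (exp_pos _).le) (mem_univ s)

lemma logSumExp_le {w : S → ℝ} {M : ℝ} (h : ∀ s, w s ≤ M) :
    logSumExp w ≤ log (Fintype.card S) + M := by
  rw [logSumExp, log_le_iff_le_exp (sum_exp_pos w), exp_add,
    exp_log (by exact_mod_cast Fintype.card_pos), ← nsmul_eq_mul]
  exact sum_le_card_nsmul _ _ _ fun s _ => exp_le_exp.2 (h s)

end Softmax

/-! ### The interpolating process -/

section Interpolation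

/-- A pair of Gaussian processes indexed by `S`, realised as linear images of one standard Gaussian
vector `G` of `E`: the `V`-valued processes `A s G` and `B s G`, and the real process `⟪a s, G⟫`.
The covariances of `A` and `B` are the matrices `p` and `q` (times the identity of `V`), that of the
real process is `q`, and the three processes are uncorrelated. The last three fields compare `p` and
`q`; for `p s t = ‖s‖ * ‖t‖` and `q s t = ⟪s, t⟫` they are elementary. -/
structure ComparisonData (E V S : Type*) [NormedAddCommGroup E] [InnerProductSpace ℝ E]
    [FiniteDimensional ℝ E] [NormedAddCommGroup V] [InnerProductSpace ℝ V]
    [FiniteDimensional ℝ V] where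
  A : S → E →L[ℝ] V
  B : S → E →L[ℝ] V
  a : S → E
  p : S → S → ℝ
  q : S → S → ℝ
  A_adjoint_A : ∀ s t v, A s ((A t).adjoint v) = p s t • v
  B_adjoint_B : ∀ s t v, B s ((B t).adjoint v) = q s t • v
  A_adjoint_B : ∀ s t v, A s ((B t).adjoint v) = 0
  B_adjoint_A : ∀ s t v, B s ((A t).adjoint v) = 0
  A_a : ∀ s t, A s (a t) = 0
  B_a : ∀ s t, B s (a t) = 0
  inner_a : ∀ s t, ⟪a s, a t⟫ = q s t
  p_diag : ∀ s, p s s = q s s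
  q_le_p : ∀ s t, q s t ≤ p s t
  p_le : ∀ s t, 2 * p s t ≤ q s s + q t t

namespace ComparisonData

section Path

variable {E V S : Type*} [NormedAddCommGroup E] [InnerProductSpace ℝ E] [FiniteDimensional ℝ E]
  [NormedAddCommGroup V] [InnerProductSpace ℝ V] [FiniteDimensional ℝ V]
  (D : ComparisonData E V S) {F : S → V → ℝ}

/-- The rotation `cos θ • A + sin θ • B` from the process `A` to the process `B`. -/
noncomputable def rot (θ : ℝ) (s : S) : E →L[ℝ] V := cos θ • D.A s + sin θ • D.B s

/-- The derivative of `rot` with respect to the angle. -/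
noncomputable def rotDeriv (θ : ℝ) (s : S) : E →L[ℝ] V := -sin θ • D.A s + cos θ • D.B s

/-- The interpolating process `β (F s (rot θ s G) + cos θ ⟪a s, G⟫)`, with inverse temperature
`β`. -/
noncomputable def path (F : S → V → ℝ) (β θ : ℝ) (x : E) (s : S) : ℝ :=
  β * (F s (D.rot θ s x) + cos θ * ⟪D.a s, x⟫)

lemma rotDeriv_adjoint (θ : ℝ) (s : S) (v : V) :
    (D.rotDeriv θ s).adjoint v = -sin θ • (D.A s).adjoint v + cos θ • (D.B s).adjoint v := by
  refine ext_inner_right ℝ fun x => ?_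
  simp [rotDeriv, ContinuousLinearMap.adjoint_inner_left, inner_add_left,
    inner_smul_left, -neg_smul]

lemma rot_adjoint_rotDeriv (θ : ℝ) (s t : S) (v : V) :
    D.rot θ t ((D.rotDeriv θ s).adjoint v) = (sin θ * cos θ * (D.q t s - D.p t s)) • v := by
  simp only [rot, rotDeriv_adjoint, map_add, map_smul, add_apply,
    smul_apply, D.A_adjoint_A, D.A_adjoint_B, D.B_adjoint_A, D.B_adjoint_B]
  module

lemma rot_a (θ : ℝ) (s t : S) : D.rot θ s (D.a t) = 0 := by
  simp [rot, D.A_a, D.B_a]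

lemma inner_a_adjoint_rotDeriv (θ : ℝ) (s t : S) (v : V) :
    ⟪D.a t, (D.rotDeriv θ s).adjoint v⟫ = 0 := by
  rw [ContinuousLinearMap.adjoint_inner_right]
  simp [rotDeriv, D.A_a, D.B_a]

lemma continuous_path (hF : ∀ s, Continuous (F s)) (β θ : ℝ) : Continuous (D.path F β θ) := by
  refine continuous_pi fun s => ?_
  have := hF s
  unfold path
  fun_prop

lemma hasDerivAt_path (hF : ∀ s, ContDiff ℝ 1 (F s)) (β θ : ℝ) (x : E) (s : S) :
    HasDerivAt (fun θ => D.path F β θ x s)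
      (β * (fderiv ℝ (F s) (D.rot θ s x) (D.rotDeriv θ s x) - sin θ * ⟪D.a s, x⟫)) θ := by
  have h1 : HasDerivAt (fun θ => D.rot θ s x) (D.rotDeriv θ s x) θ := by
    simpa [rot, rotDeriv] using
      ((hasDerivAt_cos θ).smul_const (D.A s x)).fun_add ((hasDerivAt_sin θ).smul_const (D.B s x))
  have h2 := ((hF s).differentiable one_ne_zero (D.rot θ s x)).hasFDerivAt.comp_hasDerivAt θ h1
  convert! (h2.add ((hasDerivAt_cos θ).mul_const ⟪D.a s, x⟫)).const_mul β using 1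
  ring

lemma hasDerivAt_path_line (hF : ∀ s, ContDiff ℝ 1 (F s)) (β θ : ℝ) (x v : E) (s : S) :
    HasDerivAt (fun r : ℝ => D.path F β θ (x + r • v) s)
      (β * (fderiv ℝ (F s) (D.rot θ s x) (D.rot θ s v) + cos θ * ⟪D.a s, v⟫)) 0 := by
  have h1 : HasDerivAt (fun r : ℝ => D.rot θ s (x + r • v)) (D.rot θ s v) 0 := by
    simpa using ((hasDerivAt_id (0 : ℝ)).smul_const (D.rot θ s v)).const_add (D.rot θ s x)
  have h2 : HasDerivAt (fun r : ℝ => ⟪D.a s, x + r • v⟫) ⟪D.a s, v⟫ 0 := by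
    simpa [inner_add_right, inner_smul_right] using
      ((hasDerivAt_id (0 : ℝ)).mul_const ⟪D.a s, v⟫).const_add ⟪D.a s, x⟫
  have h3 := ((hF s).differentiable one_ne_zero (D.rot θ s x)).hasFDerivAt.comp_hasDerivAt_of_eq
    (0 : ℝ) h1 (by simp)
  exact (h3.add (h2.const_mul (cos θ))).const_mul β

lemma abs_path_speed_le (hL : ∀ s, LipschitzWith 1 (F s)) (β θ : ℝ) (x : E) (s : S) :
    |β * (fderiv ℝ (F s) (D.rot θ s x) (D.rotDeriv θ s x) - sin θ * ⟪D.a s, x⟫)| ≤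
      |β| * ((‖D.A s‖ + ‖D.B s‖ + ‖D.a s‖) * ‖x‖) := by
  have h1 : |fderiv ℝ (F s) (D.rot θ s x) (D.rotDeriv θ s x)| ≤ ‖D.rotDeriv θ s x‖ := by
    simpa using (fderiv ℝ (F s) (D.rot θ s x)).le_of_opNorm_le
      (norm_fderiv_le_of_lipschitz ℝ (hL s)) (D.rotDeriv θ s x)
  have h2 : ‖D.rotDeriv θ s x‖ ≤ ‖D.A s‖ * ‖x‖ + ‖D.B s‖ * ‖x‖ := by
    rw [rotDeriv, add_apply, smul_apply, smul_apply]
    refine (norm_add_le _ _).trans (add_le_add ?_ ?_)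
    · rw [norm_smul, norm_neg]
      exact (mul_le_of_le_one_left (norm_nonneg _) (abs_sin_le_one θ)).trans ((D.A s).le_opNorm x)
    · rw [norm_smul]
      exact (mul_le_of_le_one_left (norm_nonneg _) (abs_cos_le_one θ)).trans ((D.B s).le_opNorm x)
  have h3 : |sin θ * ⟪D.a s, x⟫| ≤ ‖D.a s‖ * ‖x‖ := by
    rw [abs_mul]
    exact (mul_le_of_le_one_left (abs_nonneg _) (abs_sin_le_one θ)).trans
      (abs_real_inner_le_norm _ _)
  rw [abs_mul]
  gcongr
  refine (abs_sub _ _).trans ?_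
  linarith

/-- The sign of the derivative of the free energy: `σ` stands for the Gibbs weights, and `I` for the
scalar products of the gradients. -/
lemma pairwise_speed_nonpos [Fintype S] {σ : S → ℝ} (hσ : ∀ s, 0 ≤ σ s) {I : S → S → ℝ}
    (hI : ∀ s t, I t s ≤ 1) :
    ∑ s, σ s * ∑ t, σ t * ((D.p t s - D.q t s) * I t s - (D.q s s - D.q t s)) ≤ 0 := by
  have h1 : ∀ s t, σ s * (σ t * ((D.p t s - D.q t s) * I t s - (D.q s s - D.q t s))) ≤
      σ s * (σ t * (1 / 2 * (D.q t t - D.q s s))) := fun s t => by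
    refine mul_le_mul_of_nonneg_left (mul_le_mul_of_nonneg_left ?_ (hσ t)) (hσ s)
    have := mul_le_of_le_one_right (sub_nonneg.2 (D.q_le_p t s)) (hI s t)
    linarith [D.p_le t s]
  have h2 : ∑ s, ∑ t, σ s * (σ t * (1 / 2 * (D.q t t - D.q s s))) = 0 := by
    -- symmetrisation: the sum is invariant under the exchange of `s` and `t`
    have h3 : ∑ s, ∑ t, σ s * (σ t * (1 / 2 * D.q t t)) =
        ∑ s, ∑ t, σ s * (σ t * (1 / 2 * D.q s s)) := by
      rw [sum_comm]
      exact sum_congr rfl fun s _ => sum_congr rfl fun t _ => by ring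
    simp only [mul_sub, sum_sub_distrib, h3, sub_self]
  simp only [mul_sum]
  exact (sum_le_sum fun s _ => sum_le_sum fun t _ => h1 s t).trans h2.le

end Path

variable {E V S : Type*} [NormedAddCommGroup E] [InnerProductSpace ℝ E] [FiniteDimensional ℝ E]
  [MeasurableSpace E] [BorelSpace E]
  [NormedAddCommGroup V] [InnerProductSpace ℝ V] [FiniteDimensional ℝ V] [Fintype S] [Nonempty S]
  (D : ComparisonData E V S) {F : S → V → ℝ}

/-- Integration by parts for a Gibbs weight against the real process: in the direction `a s` only
the real process varies. -/
lemma integral_softmax_mul_inner (hF : ∀ s, ContDiff ℝ 1 (F s)) (β θ : ℝ) (s : S) :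
    ∫ x, softmax (D.path F β θ x) s * ⟪D.a s, x⟫ ∂(stdGaussian E) =
      ∫ x, softmax (D.path F β θ x) s * ∑ t, softmax (D.path F β θ x) t *
        (β * cos θ * (D.q s s - D.q t s)) ∂(stdGaussian E) := by
  have hc := D.continuous_path (fun s => (hF s).continuous) β θ
  have hs : ∀ s, Continuous fun x => softmax (D.path F β θ x) s :=
    fun s => (continuous_softmax s).comp hc
  simp only [mul_comm _ ⟪D.a s, _⟫]
  refine integral_inner_mul_stdGaussian (hs s) (by fun_prop)
    (fun x => abs_softmax_le_one _ s) (fun x => abs_softmax_mul_sum_le _ s fun t => le_rfl) ?_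
  · intro x
    have h := hasDerivAt_softmax (D.hasDerivAt_path_line hF β θ x (D.a s)) s
    simp only [D.rot_a, D.inner_a, map_zero, zero_add, zero_smul, add_zero] at h
    unfold HasLineDerivAt
    convert! h using 1
    congr 1
    exact sum_congr rfl fun t _ => by ring

/-- Integration by parts for a Gibbs weight times a partial derivative of `F s` at `rot θ s x`,
in the direction `(rotDeriv θ s)† v`. As `rot θ s` vanishes in that direction, the second derivative
of `F s` does not occur. -/
lemma integral_inner_mul_softmax_mul_fderiv (hF : ∀ s, ContDiff ℝ 1 (F s))
    (hL : ∀ s, LipschitzWith 1 (F s)) (β θ : ℝ) (s : S) (v : V) :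
    ∫ x, ⟪v, D.rotDeriv θ s x⟫ *
        (softmax (D.path F β θ x) s * fderiv ℝ (F s) (D.rot θ s x) v) ∂(stdGaussian E) =
      ∫ x, softmax (D.path F β θ x) s * ∑ t, softmax (D.path F β θ x) t *
        (β * (sin θ * cos θ) * (D.p t s - D.q t s) *
          (fderiv ℝ (F t) (D.rot θ t x) v * fderiv ℝ (F s) (D.rot θ s x) v))
        ∂(stdGaussian E) := by
  have hc := D.continuous_path (fun s => (hF s).continuous) β θ
  have hs : ∀ s, Continuous fun x => softmax (D.path F β θ x) s :=
    fun s => (continuous_softmax s).comp hc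
  have hd : ∀ s, Continuous fun x => fderiv ℝ (F s) (D.rot θ s x) v := fun s =>
    (((hF s).continuous_fderiv one_ne_zero).comp (D.rot θ s).continuous).clm_apply continuous_const
  have hb : ∀ s x, |fderiv ℝ (F s) (D.rot θ s x) v| ≤ ‖v‖ := fun s x => by
    simpa using (fderiv ℝ (F s) (D.rot θ s x)).le_of_opNorm_le
      (norm_fderiv_le_of_lipschitz ℝ (hL s)) v
  simp only [← ContinuousLinearMap.adjoint_inner_left]
  refine integral_inner_mul_stdGaussian (C := ‖v‖)
    (C' := ∑ t, |β * (sin θ * cos θ) * (D.p t s - D.q t s)| * (‖v‖ * ‖v‖))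
    ((hs s).mul (hd s)) ?_ ?_ ?_ ?_
  · fun_prop
  · intro x
    rw [abs_mul]
    exact (mul_le_of_le_one_left (abs_nonneg _) (abs_softmax_le_one _ s)).trans (hb s x)
  · intro x
    refine abs_softmax_mul_sum_le _ s fun t => ?_
    rw [abs_mul, abs_mul _ (fderiv ℝ (F s) (D.rot θ s x) v)]
    gcongr
    exacts [hb t x, hb s x]
  · intro x
    set w := (D.rotDeriv θ s).adjoint v
    have h := hasDerivAt_softmax (D.hasDerivAt_path_line hF β θ x w) s
    have h2 := h.mul_const (fderiv ℝ (F s) (D.rot θ s x) v)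
    -- the position of `s` does not move, since `p s s = q s s`
    have hw : D.rot θ s w = 0 := by simp [w, D.rot_adjoint_rotDeriv, D.p_diag]
    have hw' : ∀ t, D.rot θ t w = (sin θ * cos θ * (D.q t s - D.p t s)) • v :=
      fun t => D.rot_adjoint_rotDeriv θ s t v
    have hi : ∀ t, ⟪D.a t, w⟫ = 0 := fun t => D.inner_a_adjoint_rotDeriv θ s t v
    unfold HasLineDerivAt
    convert! h2 using 1
    · ext r
      simp [hw]
    · rw [mul_assoc, sum_mul]
      simp only [zero_smul, add_zero, hi, hw, hw', map_zero, map_smul, smul_eq_mul]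
      congr 1
      exact sum_congr rfl fun t _ => by ring

end ComparisonData
end Interpolation

/-! ### The free energy and its derivative -/

/-- A Lipschitz function grows at most linearly, and Gaussian vectors have a first moment. -/
lemma integrable_lipschitz_comp_stdGaussian {E V : Type*} [NormedAddCommGroup E]
    [InnerProductSpace ℝ E] [FiniteDimensional ℝ E] [MeasurableSpace E] [BorelSpace E]
    [NormedAddCommGroup V] [NormedSpace ℝ V] {f : V → ℝ} (hf : LipschitzWith 1 f) (L : E →L[ℝ] V) :
    Integrable (fun x => f (L x)) (stdGaussian E) := by
  have h0 : Integrable (fun x => |f 0| + ‖L‖ * ‖x‖) (stdGaussian E) :=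
    (integrable_const _).add ((IsGaussian.integrable_id (μ := stdGaussian E)).norm.const_mul _)
  refine h0.mono' ((hf).continuous.comp L.continuous).aestronglyMeasurable
    (Eventually.of_forall fun x => ?_)
  have h1 := (hf).dist_le_mul (L x) 0
  rw [Real.dist_eq, dist_zero_right, NNReal.coe_one, one_mul] at h1
  have h2 := L.le_opNorm x
  have h3 := abs_sub_abs_le_abs_sub (f (L x)) (f 0)
  rw [norm_eq_abs]
  linarith

section Interpolation
namespace ComparisonData
variable {E V S : Type*} [NormedAddCommGroup E] [InnerProductSpace ℝ E] [FiniteDimensional ℝ E]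
  [MeasurableSpace E] [BorelSpace E]
  [NormedAddCommGroup V] [InnerProductSpace ℝ V] [FiniteDimensional ℝ V] [Fintype S] [Nonempty S]
  (D : ComparisonData E V S) {F : S → V → ℝ}

omit [Fintype S] [Nonempty S] in
lemma integrable_path (hL : ∀ s, LipschitzWith 1 (F s)) (β θ : ℝ) (s : S) :
    Integrable (fun x => D.path F β θ x s) (stdGaussian E) :=
  ((integrable_lipschitz_comp_stdGaussian (hL s) (D.rot θ s)).add
    ((IsGaussian.integrable_dual (stdGaussian E) (innerSL ℝ (D.a s))).const_mul _)).const_mul _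

/-- Integration by parts for the Lipschitz part of the process, obtained by summing
`integral_inner_mul_softmax_mul_fderiv` over an orthonormal basis of `V`. -/
lemma integral_softmax_mul_fderiv (hF : ∀ s, ContDiff ℝ 1 (F s))
    (hL : ∀ s, LipschitzWith 1 (F s)) (β θ : ℝ) (s : S) :
    ∫ x, softmax (D.path F β θ x) s * fderiv ℝ (F s) (D.rot θ s x) (D.rotDeriv θ s x)
        ∂(stdGaussian E) =
      ∫ x, softmax (D.path F β θ x) s * ∑ t, softmax (D.path F β θ x) t *
        (β * (sin θ * cos θ) * (D.p t s - D.q t s) *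
          ⟪gradient (F t) (D.rot θ t x), gradient (F s) (D.rot θ s x)⟫) ∂(stdGaussian E) := by
  have hc := D.continuous_path (fun s => (hF s).continuous) β θ
  have hs : ∀ s, Continuous fun x => softmax (D.path F β θ x) s :=
    fun s => (continuous_softmax s).comp hc
  have hd : ∀ s v, Continuous fun x => fderiv ℝ (F s) (D.rot θ s x) v := fun s v =>
    (((hF s).continuous_fderiv one_ne_zero).comp (D.rot θ s).continuous).clm_apply continuous_const
  have hb : ∀ s x v, |fderiv ℝ (F s) (D.rot θ s x) v| ≤ ‖v‖ := fun s x v => by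
    simpa using (fderiv ℝ (F s) (D.rot θ s x)).le_of_opNorm_le
      (norm_fderiv_le_of_lipschitz ℝ (hL s)) v
  let b := stdOrthonormalBasis ℝ V
  have h1 : ∀ x, softmax (D.path F β θ x) s *
      fderiv ℝ (F s) (D.rot θ s x) (D.rotDeriv θ s x) =
      ∑ k, ⟪b k, D.rotDeriv θ s x⟫ *
        (softmax (D.path F β θ x) s * fderiv ℝ (F s) (D.rot θ s x) (b k)) := by
    intro x
    conv_lhs => rw [← b.sum_repr' (D.rotDeriv θ s x), map_sum, mul_sum]
    refine sum_congr rfl fun k _ => ?_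
    rw [map_smul, smul_eq_mul]
    ring
  have h2 : ∀ x, softmax (D.path F β θ x) s * ∑ t, softmax (D.path F β θ x) t *
      (β * (sin θ * cos θ) * (D.p t s - D.q t s) *
        ⟪gradient (F t) (D.rot θ t x), gradient (F s) (D.rot θ s x)⟫) =
      ∑ k, softmax (D.path F β θ x) s * ∑ t, softmax (D.path F β θ x) t *
        (β * (sin θ * cos θ) * (D.p t s - D.q t s) *
          (fderiv ℝ (F t) (D.rot θ t x) (b k) * fderiv ℝ (F s) (D.rot θ s x) (b k))) := by
    intro x
    rw [← mul_sum, sum_comm]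
    congr 1
    refine sum_congr rfl fun t _ => ?_
    rw [← mul_sum, ← mul_sum, ← b.sum_inner_mul_inner]
    simp only [real_inner_comm _ (b _), inner_gradient_left]
  simp only [h1, h2]
  rw [integral_finsetSum, integral_finsetSum]
  · exact sum_congr rfl fun k _ => D.integral_inner_mul_softmax_mul_fderiv hF hL β θ s (b k)
  · intro k _
    refine .of_bound (Continuous.aestronglyMeasurable (by fun_prop))
      (∑ t, |β * (sin θ * cos θ) * (D.p t s - D.q t s)| * (‖b k‖ * ‖b k‖))
      (Eventually.of_forall fun x => abs_softmax_mul_sum_le _ s fun t => ?_)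
    rw [abs_mul, abs_mul _ (fderiv ℝ (F s) (D.rot θ s x) (b k))]
    gcongr
    exacts [hb t x _, hb s x _]
  · intro k _
    have hi : Integrable (fun x => ⟪b k, D.rotDeriv θ s x⟫) (stdGaussian E) :=
      IsGaussian.integrable_dual (stdGaussian E) ((innerSL ℝ (b k)).comp (D.rotDeriv θ s))
    refine hi.mul_bdd (c := ‖b k‖) (Continuous.aestronglyMeasurable (by fun_prop))
      (Eventually.of_forall fun x => ?_)
    rw [norm_mul]
    exact (mul_le_of_le_one_left (norm_nonneg _) (abs_softmax_le_one _ s)).trans (hb s x _)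

/-- The free energy of the interpolating process: the expectation of its soft maximum. -/
noncomputable def freeEnergy (F : S → V → ℝ) (β θ : ℝ) : ℝ :=
  ∫ x, logSumExp (D.path F β θ x) ∂(stdGaussian E)

lemma integrable_logSumExp_path (hF : ∀ s, ContDiff ℝ 1 (F s)) (hL : ∀ s, LipschitzWith 1 (F s))
    (β θ : ℝ) : Integrable (fun x => logSumExp (D.path F β θ x)) (stdGaussian E) := by
  have h0 : Integrable (fun x => |log (Fintype.card S)| + ∑ s, |D.path F β θ x s|)
      (stdGaussian E) :=
    (integrable_const _).add (integrable_finsetSum _ fun s _ => (D.integrable_path hL β θ s).abs)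
  refine h0.mono' (continuous_logSumExp.comp
    (D.continuous_path (fun s => (hF s).continuous) β θ)).aestronglyMeasurable
    (Eventually.of_forall fun x => ?_)
  have hs : ∀ s, |D.path F β θ x s| ≤ ∑ s, |D.path F β θ x s| := fun s =>
    single_le_sum (f := fun s => |D.path F β θ x s|) (fun t _ => abs_nonneg _) (mem_univ s)
  have h1 := logSumExp_le fun s => (le_abs_self _).trans (hs s)
  obtain ⟨s⟩ := ‹Nonempty S›
  have h2 := le_logSumExp (D.path F β θ x) s
  have h3 := neg_abs_le (D.path F β θ x s)
  have h4 := hs s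
  rw [norm_eq_abs, abs_le]
  have h5 := le_abs_self (log (Fintype.card S))
  have h6 := abs_nonneg (log (Fintype.card S))
  constructor <;> linarith

lemma hasDerivAt_freeEnergy (hF : ∀ s, ContDiff ℝ 1 (F s)) (hL : ∀ s, LipschitzWith 1 (F s))
    (β θ : ℝ) :
    HasDerivAt (D.freeEnergy F β)
      (∫ x, ∑ s, softmax (D.path F β θ x) s *
        (β * (fderiv ℝ (F s) (D.rot θ s x) (D.rotDeriv θ s x) - sin θ * ⟪D.a s, x⟫))
        ∂(stdGaussian E)) θ := by
  have hc := fun θ => D.continuous_path (fun s => (hF s).continuous) β θ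
  have hs : ∀ s, Continuous fun x => softmax (D.path F β θ x) s :=
    fun s => (continuous_softmax s).comp (hc θ)
  have hd : ∀ s, Continuous fun x => fderiv ℝ (F s) (D.rot θ s x) (D.rotDeriv θ s x) := fun s =>
    (((hF s).continuous_fderiv one_ne_zero).comp (D.rot θ s).continuous).clm_apply
      (D.rotDeriv θ s).continuous
  refine (hasDerivAt_integral_of_dominated_loc_of_deriv_le (μ := stdGaussian E)
    (F := fun θ x => logSumExp (D.path F β θ x))
    (F' := fun θ x => ∑ s, softmax (D.path F β θ x) s *
      (β * (fderiv ℝ (F s) (D.rot θ s x) (D.rotDeriv θ s x) - sin θ * ⟪D.a s, x⟫)))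
    (s := Set.univ) (bound := fun x => ∑ s, |β| * ((‖D.A s‖ + ‖D.B s‖ + ‖D.a s‖) * ‖x‖))
    Filter.univ_mem
    (Eventually.of_forall fun θ => (continuous_logSumExp.comp (hc θ)).aestronglyMeasurable)
    (D.integrable_logSumExp_path hF hL β θ) (Continuous.aestronglyMeasurable ?_) ?_ ?_ ?_).2
  · fun_prop
  · refine Eventually.of_forall fun x θ _ => ?_
    refine (norm_sum_le _ _).trans (sum_le_sum fun s _ => ?_)
    rw [norm_mul]
    exact (mul_le_of_le_one_left (norm_nonneg _) (abs_softmax_le_one _ s)).trans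
      (D.abs_path_speed_le hL β θ x s)
  · exact integrable_finsetSum _ fun s _ =>
      (((IsGaussian.integrable_id (μ := stdGaussian E)).norm.const_mul _).const_mul _)
  · exact Eventually.of_forall fun x θ _ =>
      hasDerivAt_logSumExp fun s => D.hasDerivAt_path hF β θ x s

end ComparisonData
end Interpolation

/-! ### Comparison of finite maxima -/

section Mollification

variable {V : Type*} [NormedAddCommGroup V] [InnerProductSpace ℝ V] [FiniteDimensional ℝ V]
  [MeasurableSpace V] [BorelSpace V]

/-- Convolution with a bump function of radius `ε` moves a `1`-Lipschitz function by at most `ε`. -/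
lemma exists_contDiff_lipschitz_approx {f : V → ℝ} (hf : LipschitzWith 1 f) {ε : ℝ} (hε : 0 < ε) :
    ∃ g : V → ℝ, ContDiff ℝ 1 g ∧ LipschitzWith 1 g ∧ ∀ x, |g x - f x| ≤ ε := by
  let φ : ContDiffBump (0 : V) := ⟨ε / 2, ε, by positivity, by linarith⟩
  refine ⟨convolution (φ.normed volume) f (ContinuousLinearMap.lsmul ℝ ℝ) volume,
    φ.hasCompactSupport_normed.contDiff_convolution_left _ φ.contDiff_normed
      hf.continuous.locallyIntegrable, ?_, fun x => ?_⟩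
  · have hi : ∀ x, Integrable fun t => φ.normed volume t * f (x - t) := fun x =>
      (φ.continuous_normed.mul (hf.continuous.comp
        (continuous_const.sub continuous_id))).integrable_of_hasCompactSupport
        φ.hasCompactSupport_normed.mul_right
    refine LipschitzWith.of_dist_le_mul fun x y => ?_
    simp only [convolution_def, ContinuousLinearMap.lsmul_apply, smul_eq_mul]
    rw [dist_eq_norm, ← integral_sub (hi x) (hi y), NNReal.coe_one, one_mul]
    calc _ ≤ ∫ t, φ.normed volume t * dist x y := by
          refine norm_integral_le_of_norm_le (φ.integrable_normed.mul_const _)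
            (Eventually.of_forall fun t => ?_)
          rw [← mul_sub, norm_mul, norm_of_nonneg (φ.nonneg_normed t)]
          refine mul_le_mul_of_nonneg_left ?_ (φ.nonneg_normed t)
          simpa [dist_eq_norm] using hf.dist_le_mul (x - t) (y - t)
      _ = dist x y := by rw [integral_mul_const, φ.integral_normed, one_mul]
  · rw [← Real.dist_eq]
    refine φ.dist_normed_convolution_le hf.continuous.aestronglyMeasurable fun y hy => ?_
    have := hf.dist_le_mul y x
    simp only [NNReal.coe_one, one_mul] at this
    exact this.trans (Metric.mem_ball.1 hy).le

end Mollification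

lemma integrable_finset_sup' {Ω S : Type*} [MeasurableSpace Ω] {μ : Measure Ω} {s : Finset S}
    (hs : s.Nonempty) {f : S → Ω → ℝ} (hf : ∀ i ∈ s, Integrable (f i) μ) :
    Integrable (fun x => s.sup' hs fun i => f i x) μ := by
  have := sup'_induction hs (p := fun g => Integrable g μ) f (fun _ h₁ _ h₂ => h₁.sup h₂) hf
  convert this using 1
  ext x
  simp

section Interpolation
namespace ComparisonData
variable {E V S : Type*} [NormedAddCommGroup E] [InnerProductSpace ℝ E] [FiniteDimensional ℝ E]
  [MeasurableSpace E] [BorelSpace E]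
  [NormedAddCommGroup V] [InnerProductSpace ℝ V] [FiniteDimensional ℝ V] [Fintype S] [Nonempty S]
  (D : ComparisonData E V S) {F : S → V → ℝ}

/-- The free energy is nonincreasing along the rotation, at every inverse temperature. -/
lemma freeEnergy_le (hF : ∀ s, ContDiff ℝ 1 (F s)) (hL : ∀ s, LipschitzWith 1 (F s)) (β : ℝ) :
    D.freeEnergy F β (π / 2) ≤ D.freeEnergy F β 0 := by
  have hd := D.hasDerivAt_freeEnergy hF hL β
  refine antitoneOn_of_deriv_nonpos (convex_Icc 0 (π / 2))
    (fun θ _ => (hd θ).continuousAt.continuousWithinAt)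
    (fun θ _ => (hd θ).differentiableAt.differentiableWithinAt) (fun θ hθ => ?_)
    (by simp; positivity) (by simp; positivity) (by positivity)
  rw [interior_Icc] at hθ
  have hsc : 0 ≤ sin θ * cos θ := mul_nonneg
    (sin_nonneg_of_nonneg_of_le_pi hθ.1.le (by linarith [hθ.2, pi_pos]))
    (cos_nonneg_of_neg_pi_div_two_le_of_le (by linarith [hθ.1, pi_pos]) hθ.2.le)
  have hc := D.continuous_path (fun s => (hF s).continuous) β θ
  have hs : ∀ s, Continuous fun x => softmax (D.path F β θ x) s :=
    fun s => (continuous_softmax s).comp hc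
  have hfd : ∀ s, Continuous fun x => fderiv ℝ (F s) (D.rot θ s x) := fun s =>
    ((hF s).continuous_fderiv one_ne_zero).comp (D.rot θ s).continuous
  have hd' : ∀ s, Continuous fun x => fderiv ℝ (F s) (D.rot θ s x) (D.rotDeriv θ s x) :=
    fun s => (hfd s).clm_apply (D.rotDeriv θ s).continuous
  have hg : ∀ s, Continuous fun x => gradient (F s) (D.rot θ s x) := fun s =>
    (InnerProductSpace.toDual ℝ V).symm.continuous.comp (hfd s)
  have hn : ∀ s v, ‖gradient (F s) v‖ ≤ 1 := fun s v => by
    simpa [gradient] using norm_fderiv_le_of_lipschitz ℝ (hL s) (x₀ := v)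
  have hI : ∀ s t x, |⟪gradient (F t) (D.rot θ t x), gradient (F s) (D.rot θ s x)⟫| ≤ 1 :=
    fun s t x => (abs_real_inner_le_norm _ _).trans
      (mul_le_one₀ (hn t _) (norm_nonneg _) (hn s _))
  have i1 : ∀ s, Integrable (fun x => softmax (D.path F β θ x) s *
      fderiv ℝ (F s) (D.rot θ s x) (D.rotDeriv θ s x)) (stdGaussian E) := fun s => by
    refine ((IsGaussian.integrable_id (μ := stdGaussian E)).norm.const_mul
      ‖D.rotDeriv θ s‖).mono' (Continuous.aestronglyMeasurable (by fun_prop))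
      (Eventually.of_forall fun x => ?_)
    rw [norm_mul]
    refine (mul_le_of_le_one_left (norm_nonneg _) (abs_softmax_le_one _ s)).trans ?_
    have h1 := (fderiv ℝ (F s) (D.rot θ s x)).le_of_opNorm_le
      (norm_fderiv_le_of_lipschitz ℝ (hL s)) (D.rotDeriv θ s x)
    rw [NNReal.coe_one, one_mul] at h1
    exact h1.trans ((D.rotDeriv θ s).le_opNorm x)
  have i2 : ∀ s, Integrable (fun x => softmax (D.path F β θ x) s * ⟪D.a s, x⟫)
      (stdGaussian E) := fun s =>
    (IsGaussian.integrable_dual (stdGaussian E) (innerSL ℝ (D.a s))).bdd_mul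
      (hs s).aestronglyMeasurable (Eventually.of_forall fun x => abs_softmax_le_one _ s)
  have i3 : ∀ s, Integrable (fun x => softmax (D.path F β θ x) s *
      ∑ t, softmax (D.path F β θ x) t * (β * (sin θ * cos θ) * (D.p t s - D.q t s) *
        ⟪gradient (F t) (D.rot θ t x), gradient (F s) (D.rot θ s x)⟫))
      (stdGaussian E) := fun s => by
    refine .of_bound (Continuous.aestronglyMeasurable (by fun_prop))
      (∑ t, |β * (sin θ * cos θ) * (D.p t s - D.q t s)|)
      (Eventually.of_forall fun x => abs_softmax_mul_sum_le _ s fun t => ?_)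
    rw [abs_mul]
    exact mul_le_of_le_one_right (abs_nonneg _) (hI s t x)
  have i4 : ∀ s, Integrable (fun x => softmax (D.path F β θ x) s *
      ∑ t, softmax (D.path F β θ x) t * (β * cos θ * (D.q s s - D.q t s)))
      (stdGaussian E) := fun s =>
    .of_bound (Continuous.aestronglyMeasurable (by fun_prop)) _
      (Eventually.of_forall fun x => abs_softmax_mul_sum_le _ s fun t => le_rfl)
  have e1 : ∀ x s, softmax (D.path F β θ x) s *
      (β * (fderiv ℝ (F s) (D.rot θ s x) (D.rotDeriv θ s x) - sin θ * ⟪D.a s, x⟫)) =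
      β * (softmax (D.path F β θ x) s * fderiv ℝ (F s) (D.rot θ s x) (D.rotDeriv θ s x)) -
        β * sin θ * (softmax (D.path F β θ x) s * ⟪D.a s, x⟫) := fun x s => by ring
  rw [(hd θ).deriv]
  simp only [e1]
  rw [integral_finsetSum]
  swap
  · exact fun s _ => ((i1 s).const_mul _).sub ((i2 s).const_mul _)
  have e2 : ∀ s, ∫ x, β * (softmax (D.path F β θ x) s *
      fderiv ℝ (F s) (D.rot θ s x) (D.rotDeriv θ s x)) -
        β * sin θ * (softmax (D.path F β θ x) s * ⟪D.a s, x⟫) ∂(stdGaussian E) =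
      ∫ x, β ^ 2 * (sin θ * cos θ) * (softmax (D.path F β θ x) s *
        ∑ t, softmax (D.path F β θ x) t * ((D.p t s - D.q t s) *
          ⟪gradient (F t) (D.rot θ t x), gradient (F s) (D.rot θ s x)⟫ -
            (D.q s s - D.q t s))) ∂(stdGaussian E) := fun s => by
    rw [integral_sub ((i1 s).const_mul _) ((i2 s).const_mul _), integral_const_mul,
      integral_const_mul, D.integral_softmax_mul_fderiv hF hL, D.integral_softmax_mul_inner hF,
      ← integral_const_mul, ← integral_const_mul,
      ← integral_sub ((i3 s).const_mul _) ((i4 s).const_mul _)]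
    refine integral_congr_ae (Eventually.of_forall fun x => ?_)
    simp only [mul_sum, ← sum_sub_distrib]
    exact sum_congr rfl fun t _ => by ring
  simp only [e2]
  rw [← integral_finsetSum _ fun s _ => ?_]
  · refine integral_nonpos fun x => ?_
    rw [← mul_sum]
    exact mul_nonpos_of_nonneg_of_nonpos (by positivity)
      (D.pairwise_speed_nonpos (softmax_nonneg _)
        (I := fun t s => ⟪gradient (F t) (D.rot θ t x), gradient (F s) (D.rot θ s x)⟫)
        fun s t => (le_abs_self _).trans (hI s t x))
  · refine Integrable.const_mul (.of_bound (Continuous.aestronglyMeasurable (by fun_prop))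
      (∑ t, (|D.p t s - D.q t s| + |D.q s s - D.q t s|))
      (Eventually.of_forall fun x => abs_softmax_mul_sum_le _ s fun t => ?_)) _
    refine (abs_sub _ _).trans (add_le_add_left ?_ _)
    rw [abs_mul]
    exact mul_le_of_le_one_right (abs_nonneg _) (hI s t x)

/-- The comparison for finitely many continuously differentiable functions. -/
lemma integral_sup'_le_of_contDiff (hF : ∀ s, ContDiff ℝ 1 (F s))
    (hL : ∀ s, LipschitzWith 1 (F s)) :
    ∫ x, univ.sup' univ_nonempty (fun s => F s (D.B s x)) ∂(stdGaussian E) ≤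
      ∫ x, univ.sup' univ_nonempty (fun s => F s (D.A s x) + ⟪D.a s, x⟫) ∂(stdGaussian E) := by
  have iB : Integrable (fun x => univ.sup' univ_nonempty (fun s => F s (D.B s x)))
      (stdGaussian E) := integrable_finset_sup' _ fun s _ =>
    integrable_lipschitz_comp_stdGaussian (hL s) (D.B s)
  have iA : Integrable (fun x => univ.sup' univ_nonempty (fun s => F s (D.A s x) + ⟪D.a s, x⟫))
      (stdGaussian E) := integrable_finset_sup' _ fun s _ =>
    (integrable_lipschitz_comp_stdGaussian (hL s) (D.A s)).add
      (IsGaussian.integrable_dual (stdGaussian E) (innerSL ℝ (D.a s)))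
  have key : ∀ β : ℝ, 0 < β →
      β * ∫ x, univ.sup' univ_nonempty (fun s => F s (D.B s x)) ∂(stdGaussian E) ≤
        log (Fintype.card S) + β * ∫ x, univ.sup' univ_nonempty
          (fun s => F s (D.A s x) + ⟪D.a s, x⟫) ∂(stdGaussian E) := by
    intro β hβ
    have h1 : β * ∫ x, univ.sup' univ_nonempty (fun s => F s (D.B s x)) ∂(stdGaussian E) ≤
        D.freeEnergy F β (π / 2) := by
      rw [← integral_const_mul]
      refine integral_mono (iB.const_mul _) (D.integrable_logSumExp_path hF hL _ _) fun x => ?_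
      obtain ⟨s, -, hs⟩ := exists_mem_eq_sup' univ_nonempty (fun s => F s (D.B s x))
      simp only [hs]
      refine le_trans (le_of_eq ?_) (le_logSumExp (D.path F β (π / 2) x) s)
      simp [path, rot]
    have h2 : D.freeEnergy F β 0 ≤ log (Fintype.card S) + β * ∫ x, univ.sup' univ_nonempty
          (fun s => F s (D.A s x) + ⟪D.a s, x⟫) ∂(stdGaussian E) := by
      have h3 : ∫ x, (log (Fintype.card S) + β * univ.sup' univ_nonempty
          (fun s => F s (D.A s x) + ⟪D.a s, x⟫)) ∂(stdGaussian E) =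
          log (Fintype.card S) + β * ∫ x, univ.sup' univ_nonempty
          (fun s => F s (D.A s x) + ⟪D.a s, x⟫) ∂(stdGaussian E) := by
        rw [integral_add (integrable_const _) (iA.const_mul _), integral_const_mul]
        simp
      rw [← h3]
      refine integral_mono (D.integrable_logSumExp_path hF hL _ _)
        ((integrable_const _).add (iA.const_mul _)) fun x => logSumExp_le fun s => ?_
      have := le_sup' (fun s => F s (D.A s x) + ⟪D.a s, x⟫) (mem_univ s)
      simpa [path, rot] using mul_le_mul_of_nonneg_left this hβ.le
    exact h1.trans ((D.freeEnergy_le hF hL β).trans h2)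
  have hlog : 0 ≤ log (Fintype.card S) := log_natCast_nonneg _
  -- `key` bounds `β` times the gap in `hlt` by `log (card S)`, so a large `β` is contradictory
  by_contra! hlt
  have h := key _ (div_pos (by linarith : 0 < log (Fintype.card S) + 1) (sub_pos.2 hlt))
  rw [← sub_le_iff_le_add, ← mul_sub, div_mul_cancel₀ _ (sub_pos.2 hlt).ne'] at h
  linarith

/-- The comparison for finitely many Lipschitz functions. -/
theorem integral_sup'_le [MeasurableSpace V] [BorelSpace V] (hL : ∀ s, LipschitzWith 1 (F s)) :
    ∫ x, univ.sup' univ_nonempty (fun s => F s (D.B s x)) ∂(stdGaussian E) ≤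
      ∫ x, univ.sup' univ_nonempty (fun s => F s (D.A s x) + ⟪D.a s, x⟫) ∂(stdGaussian E) := by
  have iB : ∀ {F : S → V → ℝ}, (∀ s, LipschitzWith 1 (F s)) →
      Integrable (fun x => univ.sup' univ_nonempty (fun s => F s (D.B s x))) (stdGaussian E) :=
    fun hL => integrable_finset_sup' _ fun s _ =>
      integrable_lipschitz_comp_stdGaussian (hL s) (D.B s)
  have iA : ∀ {F : S → V → ℝ}, (∀ s, LipschitzWith 1 (F s)) → Integrable
      (fun x => univ.sup' univ_nonempty (fun s => F s (D.A s x) + ⟪D.a s, x⟫)) (stdGaussian E) :=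
    fun hL => integrable_finset_sup' _ fun s _ =>
      (integrable_lipschitz_comp_stdGaussian (hL s) (D.A s)).add
        (IsGaussian.integrable_dual (stdGaussian E) (innerSL ℝ (D.a s)))
  refine le_of_forall_pos_le_add fun ε hε => ?_
  choose G hG hGL hGF using fun s => exists_contDiff_lipschitz_approx (hL s) (half_pos hε)
  have h1 := D.integral_sup'_le_of_contDiff hG hGL
  have h2 : ∫ x, univ.sup' univ_nonempty (fun s => F s (D.B s x)) ∂(stdGaussian E) ≤
      ∫ x, univ.sup' univ_nonempty (fun s => G s (D.B s x)) ∂(stdGaussian E) + ε / 2 := by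
    have : ∫ x, (univ.sup' univ_nonempty (fun s => G s (D.B s x)) + ε / 2) ∂(stdGaussian E) =
        ∫ x, univ.sup' univ_nonempty (fun s => G s (D.B s x)) ∂(stdGaussian E) + ε / 2 := by
      rw [integral_add (iB hGL) (integrable_const _)]
      simp
    rw [← this]
    refine integral_mono (iB hL) ((iB hGL).add (integrable_const _)) fun x =>
      sup'_le _ _ fun s _ => ?_
    have h3 := le_sup' (fun s => G s (D.B s x)) (mem_univ s)
    have h4 := (abs_le.1 (hGF s (D.B s x))).1
    linarith
  have h3 : ∫ x, univ.sup' univ_nonempty (fun s => G s (D.A s x) + ⟪D.a s, x⟫) ∂(stdGaussian E) ≤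
      ∫ x, univ.sup' univ_nonempty (fun s => F s (D.A s x) + ⟪D.a s, x⟫) ∂(stdGaussian E)
        + ε / 2 := by
    have : ∫ x, (univ.sup' univ_nonempty (fun s => F s (D.A s x) + ⟪D.a s, x⟫) + ε / 2)
        ∂(stdGaussian E) =
        ∫ x, univ.sup' univ_nonempty (fun s => F s (D.A s x) + ⟪D.a s, x⟫) ∂(stdGaussian E)
          + ε / 2 := by
      rw [integral_add (iA hL) (integrable_const _)]
      simp
    rw [← this]
    refine integral_mono (iA hGL) ((iA hL).add (integrable_const _)) fun x =>
      sup'_le _ _ fun s _ => ?_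
    have h3 := le_sup' (fun s => F s (D.A s x) + ⟪D.a s, x⟫) (mem_univ s)
    have h4 := (abs_le.1 (hGF s (D.A s x))).2
    linarith
  linarith

end ComparisonData
end Interpolation

/-! ### The joint law as a standard Gaussian measure -/

section Law

lemma stdGaussian_real_eq_gaussianReal : stdGaussian ℝ = gaussianReal 0 1 := by
  refine Measure.ext_of_charFun ?_
  ext t
  rw [charFun_stdGaussian, charFun_gaussianReal]
  congr 1
  simp [← Complex.ofReal_pow, neg_div]

variable {Ω E E' ι : Type*} [MeasurableSpace Ω] {P : Measure Ω} [IsProbabilityMeasure P]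
  [NormedAddCommGroup E] [InnerProductSpace ℝ E] [FiniteDimensional ℝ E]
  [MeasurableSpace E] [BorelSpace E]
  [NormedAddCommGroup E'] [InnerProductSpace ℝ E'] [FiniteDimensional ℝ E']
  [MeasurableSpace E'] [BorelSpace E'] [Fintype ι]

lemma hasLaw_stdGaussian_prod {X : Ω → E} {Y : Ω → E'} (hX : HasLaw X (stdGaussian E) P)
    (hY : HasLaw Y (stdGaussian E') P) (h : IndepFun X Y P) :
    HasLaw (fun ω => WithLp.toLp 2 (X ω, Y ω)) (stdGaussian (WithLp 2 (E × E'))) P := by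
  have := hX.aemeasurable
  have := hY.aemeasurable
  refine ⟨by fun_prop, ?_⟩
  have : IsProbabilityMeasure (P.map fun ω => WithLp.toLp 2 (X ω, Y ω)) :=
    Measure.isProbabilityMeasure_map (by fun_prop)
  refine Measure.ext_of_charFun ?_
  ext t
  rw [(indepFun_iff_charFun_prod hX.aemeasurable hY.aemeasurable).1 h, hX.map_eq, hY.map_eq,
    charFun_stdGaussian, charFun_stdGaussian, charFun_stdGaussian, ← Complex.exp_add]
  congr 1
  rw [← Complex.ofReal_pow ‖t‖, WithLp.prod_norm_sq_eq_of_L2]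
  push_cast
  change -(‖t.fst‖ : ℂ) ^ 2 / 2 + -(‖t.snd‖ : ℂ) ^ 2 / 2 = _
  ring

lemma hasLaw_stdGaussian_pi {X : ι → Ω → E} (hX : ∀ i, HasLaw (X i) (stdGaussian E) P)
    (h : iIndepFun X P) :
    HasLaw (fun ω => WithLp.toLp 2 (fun i => X i ω)) (stdGaussian (PiLp 2 fun _ : ι => E)) P := by
  have hm := fun i => (hX i).aemeasurable
  refine ⟨by fun_prop, ?_⟩
  have : IsProbabilityMeasure (P.map fun ω => WithLp.toLp 2 (fun i => X i ω)) :=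
    Measure.isProbabilityMeasure_map (by fun_prop)
  refine Measure.ext_of_charFun ?_
  ext t
  rw [(iIndepFun_iff_charFun_pi hm).1 h, charFun_stdGaussian]
  simp only [(hX _).map_eq, charFun_stdGaussian]
  rw [← Complex.exp_sum, ← Complex.ofReal_pow ‖t‖, PiLp.norm_sq_eq_of_L2]
  congr 1
  push_cast
  rw [← sum_neg_distrib, sum_div]

end Law

section JointSpace

/-- The space of the triples `(g, X, (Xs i)ᵢ)`, with its Euclidean structure. -/
abbrev JointSpace (n : ℕ) (V : Type*) : Type _ :=
  WithLp 2 (EuclideanSpace ℝ (Fin n) × WithLp 2 (V × PiLp 2 fun _ : Fin n => V))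

variable {n : ℕ} {V : Type*} [NormedAddCommGroup V] [InnerProductSpace ℝ V]

/-- The linear map `(g, X, Xs) ↦ ‖x‖ X`. -/
noncomputable def scaledCopy (V : Type*) [NormedAddCommGroup V] [InnerProductSpace ℝ V]
    (x : EuclideanSpace ℝ (Fin n)) : JointSpace n V →L[ℝ] V :=
  ‖x‖ • (WithLp.fstL 2 ℝ V _).comp (WithLp.sndL 2 ℝ _ _)

/-- The linear map `(g, X, Xs) ↦ ∑ i, x i Xs i`. -/
noncomputable def linearCombination (V : Type*) [NormedAddCommGroup V] [InnerProductSpace ℝ V]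
    (x : EuclideanSpace ℝ (Fin n)) : JointSpace n V →L[ℝ] V :=
  ∑ i, x i • (PiLp.proj 2 (fun _ : Fin n => V) i).comp
    ((WithLp.sndL 2 ℝ _ _).comp (WithLp.sndL 2 ℝ _ _))

lemma scaledCopy_apply (x : EuclideanSpace ℝ (Fin n)) (y : JointSpace n V) :
    scaledCopy V x y = ‖x‖ • y.snd.fst := rfl

lemma linearCombination_apply (x : EuclideanSpace ℝ (Fin n)) (y : JointSpace n V) :
    linearCombination V x y = ∑ i, x i • y.snd.snd i := by
  simp [linearCombination]

variable [FiniteDimensional ℝ V]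

lemma scaledCopy_adjoint (x : EuclideanSpace ℝ (Fin n)) (v : V) :
    (scaledCopy V x).adjoint v = WithLp.toLp 2 (0, WithLp.toLp 2 (‖x‖ • v, 0)) := by
  refine ext_inner_right ℝ fun y => ?_
  rw [ContinuousLinearMap.adjoint_inner_left, scaledCopy_apply, WithLp.prod_inner_apply,
    WithLp.prod_inner_apply]
  simp [inner_smul_left, inner_smul_right]

lemma linearCombination_adjoint (x : EuclideanSpace ℝ (Fin n)) (v : V) :
    (linearCombination V x).adjoint v =
      WithLp.toLp 2 (0, WithLp.toLp 2 (0, WithLp.toLp 2 fun i => x i • v)) := by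
  refine ext_inner_right ℝ fun y => ?_
  rw [ContinuousLinearMap.adjoint_inner_left, linearCombination_apply, WithLp.prod_inner_apply,
    WithLp.prod_inner_apply, inner_sum]
  simp [PiLp.inner_apply, inner_smul_left, inner_smul_right]

/-- The comparison data of a family of points of `ℝⁿ`: the scaled copies `‖x s‖ X`, the linear
combinations `∑ i, x s i Xs i`, and the real process `⟪x s, g⟫`. -/
noncomputable def pointComparisonData {S : Type*} (V : Type*) [NormedAddCommGroup V]
    [InnerProductSpace ℝ V] [FiniteDimensional ℝ V] (x : S → EuclideanSpace ℝ (Fin n)) :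
    ComparisonData (JointSpace n V) V S where
  A s := scaledCopy V (x s)
  B s := linearCombination V (x s)
  a s := WithLp.toLp 2 (x s, 0)
  p s t := ‖x s‖ * ‖x t‖
  q s t := ⟪x s, x t⟫
  A_adjoint_A s t v := by simp [scaledCopy_adjoint, scaledCopy_apply, smul_smul]
  B_adjoint_B s t v := by
    simp [linearCombination_adjoint, linearCombination_apply, smul_smul, PiLp.inner_apply,
      ← sum_smul, mul_comm]
  A_adjoint_B s t v := by simp [linearCombination_adjoint, scaledCopy_apply]
  B_adjoint_A s t v := by simp [scaledCopy_adjoint, linearCombination_apply]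
  A_a s t := by simp [scaledCopy_apply]
  B_a s t := by simp [linearCombination_apply]
  inner_a s t := by simp [WithLp.prod_inner_apply]
  p_diag s := (real_inner_self_eq_norm_mul_norm _).symm
  q_le_p s t := real_inner_le_norm _ _
  p_le s t := by
    rw [real_inner_self_eq_norm_sq, real_inner_self_eq_norm_sq, ← mul_assoc]
    exact two_mul_le_add_sq _ _

end JointSpace

/-! ### Extended expectations and suprema -/

section Expectation

variable {Ω Ω' : Type*} [MeasurableSpace Ω] [MeasurableSpace Ω'] {P : Measure Ω} {Q : Measure Ω'}

lemma expectation_mono {Y Z : Ω → EReal} (h : ∀ ω, Y ω ≤ Z ω) :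
    expectation P Y ≤ expectation P Z := by
  refine EReal.sub_le_sub ?_ ?_
  · exact_mod_cast lintegral_mono fun ω => EReal.toENNReal_le_toENNReal (h ω)
  · exact_mod_cast lintegral_mono fun ω =>
      EReal.toENNReal_le_toENNReal (EReal.neg_le_neg_iff.2 (h ω))

lemma expectation_coe {Z : Ω → ℝ} (hZ : Integrable Z P) :
    expectation P (fun ω => (Z ω : EReal)) = ((∫ ω, Z ω ∂P : ℝ) : EReal) := by
  have h : ∀ a : ℝ≥0∞, a ≠ ⊤ → ((a.toReal : ℝ) : EReal) = a := fun a ha => by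
    lift a to NNReal using ha
    rfl
  rw [integral_eq_lintegral_pos_part_sub_lintegral_neg_part hZ, EReal.coe_sub, expectation,
    h _ hZ.lintegral_lt_top.ne,
    h (∫⁻ ω, ENNReal.ofReal (-Z ω) ∂P) hZ.neg.lintegral_lt_top.ne]
  rfl

lemma expectation_comp_of_hasLaw {G : Ω → Ω'} (hG : HasLaw G Q P) {Z : Ω' → EReal}
    (hZ : Measurable Z) : expectation P (fun ω => Z (G ω)) = expectation Q Z := by
  rw [expectation, expectation, hG.lintegral_comp (f := fun y => (Z y).toENNReal) (by fun_prop),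
    hG.lintegral_comp (f := fun y => (-Z y).toENNReal) (by fun_prop)]

lemma hasExpectation_comp_of_hasLaw {G : Ω → Ω'} (hG : HasLaw G Q P) {Z : Ω' → EReal}
    (hZ : Measurable Z) {Y : Ω' → ℝ} (hY : Integrable Y Q) (hYZ : ∀ y, (Y y : EReal) ≤ Z y) :
    HasExpectation P (fun ω => Z (G ω)) := by
  refine ⟨hZ.comp_aemeasurable hG.aemeasurable, Or.inr ?_⟩
  rw [hG.lintegral_comp (f := fun y => (-Z y).toENNReal) (by fun_prop)]
  refine ne_top_of_le_ne_top hY.neg.lintegral_lt_top.ne (lintegral_mono fun y => ?_)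
  refine EReal.toENNReal_le_toENNReal (y := ((-Y y : ℝ) : EReal)) ?_
  rw [EReal.coe_neg]
  exact EReal.neg_le_neg_iff.2 (hYZ y)

/-- Monotone convergence: the negative parts are dominated by that of the first variable. -/
lemma expectation_iSup_le {Z : ℕ → Ω → ℝ} (hm : Monotone Z) (hZ : ∀ k, Integrable (Z k) P)
    {c : EReal} (hc : ∀ k, ((∫ ω, Z k ω ∂P : ℝ) : EReal) ≤ c) :
    expectation P (fun ω => ⨆ k, (Z k ω : EReal)) ≤ c := by
  have hmE : ∀ ω, Monotone fun k => (Z k ω : EReal) :=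
    fun ω i j hij => EReal.coe_le_coe_iff.2 (hm hij ω)
  have ht : ∀ ω, Tendsto (fun k => (Z k ω : EReal)) atTop (𝓝 (⨆ k, (Z k ω : EReal))) :=
    fun ω => tendsto_atTop_iSup (hmE ω)
  have hme : ∀ k, AEMeasurable (fun ω => (Z k ω : EReal)) P :=
    fun k => measurable_coe_real_ereal.comp_aemeasurable (hZ k).aemeasurable
  have hpos := lintegral_tendsto_of_tendsto_of_monotone (μ := P)
    (f := fun k ω => (Z k ω : EReal).toENNReal) (F := fun ω => (⨆ k, (Z k ω : EReal)).toENNReal)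
    (fun k => (hme k).ereal_toENNReal)
    (Eventually.of_forall fun ω i j hij => EReal.toENNReal_le_toENNReal (hmE ω hij))
    (Eventually.of_forall fun ω => (EReal.continuous_toENNReal.tendsto _).comp (ht ω))
  have h0 : ∫⁻ ω, (-(Z 0 ω : EReal)).toENNReal ∂P ≠ ⊤ := (hZ 0).neg.lintegral_lt_top.ne
  have hneg := lintegral_tendsto_of_tendsto_of_antitone (μ := P)
    (f := fun k ω => (-(Z k ω : EReal)).toENNReal)
    (F := fun ω => (-⨆ k, (Z k ω : EReal)).toENNReal)
    (fun k => (hme k).neg.ereal_toENNReal)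
    (Eventually.of_forall fun ω i j hij =>
      EReal.toENNReal_le_toENNReal (EReal.neg_le_neg_iff.2 (hmE ω hij)))
    h0
    (Eventually.of_forall fun ω => (EReal.continuous_toENNReal.tendsto _).comp (ht ω).neg)
  have hfin : ∫⁻ ω, (-⨆ k, (Z k ω : EReal)).toENNReal ∂P ≠ ⊤ :=
    ne_top_of_le_ne_top h0 (lintegral_mono fun ω => EReal.toENNReal_le_toENNReal
      (EReal.neg_le_neg_iff.2 (le_iSup (fun k => (Z k ω : EReal)) 0)))
  have hlim : Tendsto (fun k => expectation P (fun ω => (Z k ω : EReal))) atTop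
      (𝓝 (expectation P (fun ω => ⨆ k, (Z k ω : EReal)))) := by
    have h1 := (continuous_coe_ennreal_ereal.tendsto _).comp hpos
    have h2 := (continuous_coe_ennreal_ereal.tendsto _).comp hneg
    exact (EReal.continuousAt_add (p := (_, _))
      (Or.inr (by rwa [Ne, EReal.neg_eq_bot_iff, EReal.coe_ennreal_eq_top_iff]))
      (Or.inl (EReal.coe_ennreal_ne_bot _))).tendsto.comp
      (h1.prodMk_nhds h2.neg)
  refine le_of_tendsto' hlim fun k => ?_
  rw [expectation_coe (hZ k)]
  exact hc k

/-- By the Lindelöf property, the supremum of continuous functions is that of a sequence. -/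
lemma exists_seq_iSup_eq {X ι : Type*} [TopologicalSpace X] [SecondCountableTopology X]
    {f : ι → X → ℝ} {A : Set ι} (hA : A.Nonempty) (hf : ∀ i ∈ A, Continuous (f i)) :
    ∃ e : ℕ → ι, (∀ k, e k ∈ A) ∧ ∀ x, ⨆ i ∈ A, (f i x : EReal) = ⨆ k, (f (e k) x : EReal) := by
  obtain ⟨i₀, hi₀⟩ := hA
  let fE : ι → X → EReal := fun i x => f i x
  have hlub : IsLUB (fE '' A) (fun x => ⨆ i ∈ A, (f i x : EReal)) := by
    have h := isLUB_biSup (s := A) (f := fE)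
    convert! h using 1
    ext x
    simp [fE]
  obtain ⟨T, hT, hTc, hTl⟩ := exists_countable_lowerSemicontinuous_isLUB
    (by rintro _ ⟨i, hi, rfl⟩
        exact (continuous_coe_real_ereal.comp (hf i hi)).lowerSemicontinuous) hlub
  -- adding `fE i₀` makes the countable family non-empty, so that a sequence enumerates it
  obtain ⟨φ, hφ⟩ := (hTc.insert (fE i₀)).exists_eq_range (Set.insert_nonempty _ _)
  have hsub : ∀ k, ∃ i ∈ A, fE i = φ k := fun k => by
    have hk : φ k ∈ insert (fE i₀) T := hφ ▸ Set.mem_range_self k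
    rcases hk with hk | hk
    · exact ⟨i₀, hi₀, hk.symm⟩
    · exact hT hk
  choose e he hφe using hsub
  refine ⟨e, he, fun x => le_antisymm ?_
    (iSup_le fun k => le_biSup (fun i => (f i x : EReal)) (he k))⟩
  suffices h : (fun x => ⨆ k, (f (e k) x : EReal)) ∈ upperBounds T from hTl.2 h x
  intro g hg x
  obtain ⟨k, rfl⟩ : g ∈ Set.range φ := hφ ▸ Set.mem_insert_of_mem _ hg
  rw [← hφe k]
  exact le_iSup (fun k => (f (e k) x : EReal)) k

end Expectation

/-! ### Comparison of the suprema -/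

section Main

variable {n : ℕ} {V : Type*} [NormedAddCommGroup V] [InnerProductSpace ℝ V]
  [FiniteDimensional ℝ V] [SecondCountableTopology V] [MeasurableSpace V] [BorelSpace V]
  {A : Set (EuclideanSpace ℝ (Fin n))} {F : EuclideanSpace ℝ (Fin n) → V → ℝ}

/-- The comparison on the joint space, for an arbitrary index set. -/
theorem expectation_iSup_linearCombination_le (hA : A.Nonempty)
    (hF : ∀ x ∈ A, LipschitzWith 1 (F x)) :
    expectation (stdGaussian (JointSpace n V))
        (fun y => ⨆ x ∈ A, ((F x (linearCombination V x y) : ℝ) : EReal)) ≤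
      expectation (stdGaussian (JointSpace n V))
        (fun y => ⨆ x ∈ A, ((F x (scaledCopy V x y) + ⟪x, y.fst⟫ : ℝ) : EReal)) := by
  obtain ⟨e, he, hsup⟩ := exists_seq_iSup_eq (f := fun x y => F x (linearCombination V x y)) hA
    fun x hx => (hF x hx).continuous.comp (linearCombination V x).continuous
  simp only [hsup]
  have hi : ∀ k, Integrable (fun y => F (e k) (linearCombination V (e k) y))
      (stdGaussian (JointSpace n V)) :=
    fun k => integrable_lipschitz_comp_stdGaussian (hF _ (he k)) _
  have hi' : ∀ k, Integrable (fun y => F (e k) (scaledCopy V (e k) y) + ⟪e k, y.fst⟫)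
      (stdGaussian (JointSpace n V)) :=
    fun k => (integrable_lipschitz_comp_stdGaussian (hF _ (he k)) _).add
      (IsGaussian.integrable_dual (stdGaussian (JointSpace n V))
        ((innerSL ℝ (e k)).comp (WithLp.fstL 2 ℝ _ _)))
  let Z : ℕ → JointSpace n V → ℝ := fun k y =>
    (univ : Finset (Fin (k + 1))).sup' univ_nonempty
      fun j => F (e j) (linearCombination V (e j) y)
  have hle : ∀ k (j : Fin (k + 1)) y, F (e j) (linearCombination V (e j) y) ≤ Z k y :=
    fun k j y => le_sup' (fun j : Fin (k + 1) => F (e j) (linearCombination V (e j) y)) (mem_univ j)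
  -- the maxima `Z k` over the first `k + 1` points increase to the supremum
  have hZ : ∀ y, ⨆ k, (F (e k) (linearCombination V (e k) y) : EReal) = ⨆ k, (Z k y : EReal) := by
    intro y
    refine le_antisymm (iSup_mono fun k => EReal.coe_le_coe_iff.2 (hle k (Fin.last k) y))
      (iSup_le fun k => ?_)
    obtain ⟨j, -, hj⟩ := exists_mem_eq_sup' univ_nonempty
      (fun j : Fin (k + 1) => F (e j) (linearCombination V (e j) y))
    simp only [Z, hj]
    exact le_iSup (fun k => (F (e k) (linearCombination V (e k) y) : EReal)) (j : ℕ)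
  simp only [hZ]
  refine expectation_iSup_le (fun k l hkl y => ?_) (fun k => ?_) fun k => ?_
  · exact sup'_le _ _ fun j _ => hle l (Fin.castLE (by omega) j) y
  · exact integrable_finset_sup' _ fun j _ => hi j
  · have h := (pointComparisonData V fun j : Fin (k + 1) => e j).integral_sup'_le
      (F := fun j => F (e j)) fun j => hF _ (he j)
    refine (EReal.coe_le_coe_iff.2 h).trans ?_
    have hin : ∀ (j : Fin (k + 1)) (y : JointSpace n V),
        ⟪(pointComparisonData V fun j : Fin (k + 1) => e j).a j, y⟫ = ⟪e j, y.fst⟫ := fun j y => by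
      simp [pointComparisonData, WithLp.prod_inner_apply]
    have hsc : ∀ j : Fin (k + 1),
        (pointComparisonData V fun j : Fin (k + 1) => e j).A j = scaledCopy V (e j) := fun _ => rfl
    simp only [hin, hsc]
    rw [← expectation_coe (integrable_finset_sup' (univ_nonempty (α := Fin (k + 1)))
      fun j _ => hi' j)]
    refine expectation_mono fun y => ?_
    obtain ⟨j, -, hj⟩ := exists_mem_eq_sup' univ_nonempty
      (fun j : Fin (k + 1) => F (e j) (scaledCopy V (e j) y) + ⟪e j, y.fst⟫)
    refine (EReal.coe_le_coe_iff.2 hj.le).trans ?_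
    exact le_biSup (fun x => ((F x (scaledCopy V x y) + ⟪x, y.fst⟫ : ℝ) : EReal)) (he j)

end Main

end

theorem theorem1 {Ω : Type*} [MeasurableSpace Ω] (P : Measure Ω) [IsProbabilityMeasure P]
    (n d : ℕ)
    (X : Ω → EuclideanSpace ℝ (Fin d))
    (Xs : Fin n → Ω → EuclideanSpace ℝ (Fin d))
    (g : Fin n → Ω → ℝ)
    -- `X` and its copies `Xs i` are standard Gaussian vectors, the `g i` are standard Gaussian
    (hX : HasLaw X (stdGaussian (EuclideanSpace ℝ (Fin d))) P)
    (hXs : ∀ i, HasLaw (Xs i) (stdGaussian (EuclideanSpace ℝ (Fin d))) P)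
    (hg : ∀ i, HasLaw (g i) (gaussianReal 0 1) P)
    -- independence of all these variables
    (hXs_indep : iIndepFun Xs P)
    (hX_indep : IndepFun X (fun ω i => Xs i ω) P)
    (hg_indep : iIndepFun g P)
    (hg_indep_X : IndepFun (fun ω i => g i ω) (fun ω => (X ω, fun i => Xs i ω)) P)
    -- the index set and the family of Lipschitz functions
    (A : Set (EuclideanSpace ℝ (Fin n))) (hA : A.Nonempty)
    (hA_ball : A ⊆ Metric.closedBall 0 1)
    (F : EuclideanSpace ℝ (Fin n) → EuclideanSpace ℝ (Fin d) → ℝ)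
    (hF : ∀ x ∈ A, LipschitzWith 1 (F x)) :
    HasExpectation P (fun ω => ⨆ x ∈ A, ((F x (∑ i, x i • Xs i ω) : ℝ) : EReal)) ∧
    HasExpectation P (fun ω => ⨆ x ∈ A, ((F x (‖x‖ • X ω) + ∑ i, x i * g i ω : ℝ) : EReal)) ∧
    expectation P (fun ω => ⨆ x ∈ A, ((F x (∑ i, x i • Xs i ω) : ℝ) : EReal)) ≤
      expectation P (fun ω => ⨆ x ∈ A, ((F x (‖x‖ • X ω) + ∑ i, x i * g i ω : ℝ) : EReal)) := by
  let V := EuclideanSpace ℝ (Fin d)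
  let G : Ω → JointSpace n V := fun ω => WithLp.toLp 2
    (WithLp.toLp 2 fun i => g i ω, WithLp.toLp 2 (X ω, WithLp.toLp 2 fun i => Xs i ω))
  have hG : HasLaw G (stdGaussian (JointSpace n V)) P := by
    refine hasLaw_stdGaussian_prod
      (hasLaw_stdGaussian_pi (fun i => stdGaussian_real_eq_gaussianReal ▸ hg i) hg_indep)
      (hasLaw_stdGaussian_prod hX (hasLaw_stdGaussian_pi hXs hXs_indep) ?_) ?_
    · exact hX_indep.comp (φ := id) (ψ := WithLp.toLp 2) measurable_id (by fun_prop)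
    · exact hg_indep_X.comp (φ := WithLp.toLp 2)
        (ψ := fun z : V × (Fin n → V) => WithLp.toLp 2 (z.1, WithLp.toLp 2 z.2))
        (by fun_prop) (by fun_prop)
  let L : JointSpace n V → EReal := fun y => ⨆ x ∈ A, ((F x (linearCombination V x y) : ℝ) : EReal)
  let R : JointSpace n V → EReal :=
    fun y => ⨆ x ∈ A, ((F x (scaledCopy V x y) + inner ℝ x y.fst : ℝ) : EReal)
  have hLc : ∀ x ∈ A, Continuous fun y => F x (linearCombination V x y) :=
    fun x hx => (hF x hx).continuous.comp (linearCombination V x).continuous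
  have hRc : ∀ x ∈ A, Continuous fun y : JointSpace n V =>
      F x (scaledCopy V x y) + inner ℝ x y.fst :=
    fun x hx => ((hF x hx).continuous.comp (scaledCopy V x).continuous).add
      (((innerSL ℝ x).comp (WithLp.fstL 2 ℝ _ _)).continuous)
  have hLm : Measurable L := by
    obtain ⟨e, he, hsup⟩ := exists_seq_iSup_eq hA hLc
    simp only [L, hsup]
    exact Measurable.iSup fun k => (hLc _ (he k)).measurable.coe_real_ereal
  have hRm : Measurable R := by
    obtain ⟨e, he, hsup⟩ := exists_seq_iSup_eq hA hRc
    simp only [R, hsup]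
    exact Measurable.iSup fun k => (hRc _ (he k)).measurable.coe_real_ereal
  have hL : (fun ω => ⨆ x ∈ A, ((F x (∑ i, x i • Xs i ω) : ℝ) : EReal)) = fun ω => L (G ω) := by
    ext ω
    simp only [L, linearCombination_apply]
    rfl
  have hR : (fun ω => ⨆ x ∈ A, ((F x (‖x‖ • X ω) + ∑ i, x i * g i ω : ℝ) : EReal)) =
      fun ω => R (G ω) := by
    ext ω
    simp [R, G, scaledCopy_apply, PiLp.inner_apply, mul_comm]
  obtain ⟨x₀, hx₀⟩ := hA
  rw [hL, hR]
  refine ⟨?_, ?_, ?_⟩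
  · exact hasExpectation_comp_of_hasLaw hG hLm
      (integrable_lipschitz_comp_stdGaussian (hF x₀ hx₀) (linearCombination V x₀))
      fun y => le_biSup (fun x => ((F x (linearCombination V x y) : ℝ) : EReal)) hx₀
  · exact hasExpectation_comp_of_hasLaw hG hRm
      ((integrable_lipschitz_comp_stdGaussian (hF x₀ hx₀) (scaledCopy V x₀)).add
        (IsGaussian.integrable_dual (stdGaussian (JointSpace n V))
          ((innerSL ℝ x₀).comp (WithLp.fstL 2 ℝ _ _))))
      fun y => le_biSup (fun x => ((F x (scaledCopy V x y) + inner ℝ x y.fst : ℝ) : EReal)) hx₀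
  · rw [expectation_comp_of_hasLaw hG hLm, expectation_comp_of_hasLaw hG hRm]
    exact expectation_iSup_linearCombination_le ⟨x₀, hx₀⟩ hF
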